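/- Let $\mathbb{F}=\mathbb{R}$ or $\mathbb{C}$. A random matrix $\Omega\in\mathbb{F}^{m\times n}$ has the *Strong $(\varepsilon,\delta)$-JLM property* if for every unit vector $x\in\mathbb{F}^n$ and every integer $t$ with $2\le t\le\log(1/\delta)$, $$\bigl\|\,\|\Omega x\|_2^2-1\,\bigr\|_{L^t}\le\frac{\varepsilon}{e}\sqrt{\frac{t}{\log(1/\delta)}}\qquad\text{and}\qquad \mathbb{E}\bigl[\|\Omega x\|_2^2\bigr]=1,$$ where $\|Z\|_{L^t}=(\mathbb{E}|Z|^t)^{1/t}$; the second condition is required for every unit vector $x$, whether or not such an integer $t$ exists. **Lemma.** Let $P,m,n$ be integers with $P\ge 1$ and $m,n\ge 0$, and let $\varepsilon,\delta>0$. Let $\Omega_1,\dots,\Omega_P$ be independent and identically distributed realizations of a random matrix in $\mathbb{F}^{m\times n}$ that has the Strong $\bigl(\tfrac{\sqrt{P}\,\varepsilon}{4e^2},\delta\bigr)$-JLM property. Then the random matrix $$\Omega=\frac{1}{\sqrt{P}}\begin{bmatrix}\Omega_1\\ \vdots\\ \Omega_P\end{bmatrix}\in\mathbb{F}^{Pm\times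 n}$$ has the Strong $(\varepsilon,\delta)$-JLM property. -/

import Mathlib

open MeasureTheory ProbabilityTheory
open scoped Matrix

/-- Matrices carry the product (entrywise) measurable structure. -/
instance matrixMeasurableSpace {𝕜 : Type*} [MeasurableSpace 𝕜] {m n : ℕ} :
    MeasurableSpace (Matrix (Fin m) (Fin n) 𝕜) :=
  inferInstanceAs (MeasurableSpace (Fin m → Fin n → 𝕜))

/-- The random matrix `A` (defined on the probability space `(Ω, μ)`, with values in the
`m × n` matrices over `𝕜 = ℝ` or `ℂ`) has the Strong `(ε, δ)`-JLM property: for every unit vector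
`x` and every integer `2 ≤ t ≤ log (1/δ)`, the `L^t(μ)` norm of `‖A x‖₂² - 1` is at most
`(ε/e) √(t / log (1/δ))`, and `𝔼 ‖A x‖₂² = 1`. -/
structure StrongJLM {𝕜 : Type*} [RCLike 𝕜] {m n : ℕ} {Ω : Type*} [MeasurableSpace Ω]
    (A : Ω → Matrix (Fin m) (Fin n) 𝕜) (μ : Measure Ω) (ε δ : ℝ) : Prop where
  aemeasurable : AEMeasurable A μ
  moment : ∀ x : EuclideanSpace 𝕜 (Fin n), ‖x‖ = 1 →
    ∀ t : ℕ, 2 ≤ t → (t : ℝ) ≤ Real.log (1 / δ) →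
      eLpNorm (fun ω => ‖WithLp.toLp 2 (A ω *ᵥ x.ofLp)‖ ^ 2 - 1) t μ ≤
        ENNReal.ofReal (ε / Real.exp 1 * Real.sqrt (t / Real.log (1 / δ)))
  expectation : ∀ x : EuclideanSpace 𝕜 (Fin n), ‖x‖ = 1 →
    ∫ ω, ‖WithLp.toLp 2 (A ω *ᵥ x.ofLp)‖ ^ 2 ∂μ = 1

/-- The vertical stack `[A 0; A 1; …; A (P-1)]` of `P` matrices of size `m × n`: row `i * m + k` of
the stack is row `k` of the block `A i`. -/
def vstack {𝕜 : Type*} {P m n : ℕ} (A : Fin P → Matrix (Fin m) (Fin n) 𝕜) :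
    Matrix (Fin (P * m)) (Fin n) 𝕜 :=
  Matrix.of fun r j => A (finProdFinEquiv.symm r).1 (finProdFinEquiv.symm r).2 j

/-! For a unit vector x, `‖Ωx‖² - 1` is the average of P independent centered variables `Z i = ‖Ω_i
x‖² - 1`, whose k-th norms are at most `K√k` for 2 ≤ k ≤ t. It suffices that their sum has t-th norm
at most `4e²K√(Pt)`; the factor 4e² cancels the one in the hypothesis. The sum is built one summand
at a time. In `abs_add_pow_le` the term linear in z is exact, so it integrates to zero, and each
summand multiplies the bound on the t-th moment by at most 1 + θ, where θ collects the orders k ≥ 2.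
At scale R = `4eK√(Pt)`, `one_add_sum_le_exp` gives 1 + θ ≤ exp(t/P), so P summands cost e^t in all,
that is, one factor e in the norm. -/

/-- A homogeneous form of Bernoulli's inequality. -/
theorem pow_succ_le_sub_pow_add {s y : ℝ} (hy : 0 ≤ y) (hys : y ≤ s) (q : ℕ) :
    s ^ (q + 1) ≤ (s - y) ^ (q + 1) + (q + 1) * s ^ q * y := by
  induction q with
  | zero => simp
  | succ q ih =>
    have hs : 0 ≤ s := hy.trans hys
    have h1 : (s - y) ^ (q + 1) ≤ s ^ (q + 1) :=
      pow_le_pow_left₀ (by linarith) (by linarith) _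
    have h2 := mul_le_mul_of_nonneg_left ih hs
    have h3 := mul_le_mul_of_nonneg_left h1 hy
    have e1 : s ^ (q + 1 + 1) = s * s ^ (q + 1) := by ring
    have e2 : (s - y) ^ (q + 1 + 1) = s * (s - y) ^ (q + 1) - y * (s - y) ^ (q + 1) := by ring
    have e3 : s * ((s - y) ^ (q + 1) + (q + 1) * s ^ q * y)
      = s * (s - y) ^ (q + 1) + (q + 1) * s ^ (q + 1) * y := by ring
    push_cast
    linarith

/-- This is the opposite-sign case of `abs_add_pow_le`: flipping the sign of y must lose at least
twice the linear binomial term. -/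
theorem abs_sub_pow_add_le_add_pow {s y : ℝ} (hs : 0 ≤ s) (hy : 0 ≤ y) (q : ℕ) :
    |s - y| ^ (q + 2) + 2 * (q + 2) * s ^ (q + 1) * y ≤ (s + y) ^ (q + 2) := by
  induction q with
  | zero => rw [zero_add, sq_abs]; push_cast; nlinarith
  | succ q ih =>
    have h1 := mul_le_mul_of_nonneg_left ih (add_nonneg hs hy)
    -- What remains after multiplying the induction hypothesis by s + y. For y ≤ s it is Bernoulli
    -- times 2y; for s ≤ y the last term suffices.
    have key : 2 * s ^ (q + 2) * y ≤
        (s + y - |s - y|) * |s - y| ^ (q + 2) + 2 * (q + 2) * s ^ (q + 1) * y ^ 2 := by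
      rcases le_total y s with h | h
      · rw [abs_of_nonneg (sub_nonneg.2 h)]
        have := mul_le_mul_of_nonneg_left (pow_succ_le_sub_pow_add hy h (q + 1)) hy
        push_cast at this
        calc _ = 2 * (y * s ^ (q + 1 + 1)) := by ring
          _ ≤ _ := mul_le_mul_of_nonneg_left this zero_le_two
          _ = _ := by ring
      · have e : 0 ≤ (s + y - |s - y|) * |s - y| ^ (q + 2) := by
          rw [abs_of_nonpos (by linarith)]
          exact mul_nonneg (by linarith) (pow_nonneg (by linarith) _)
        have h2 : s ^ (q + 1) * y * s ≤ s ^ (q + 1) * y * y :=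
          mul_le_mul_of_nonneg_left h (by positivity)
        have h3 : 0 ≤ (q : ℝ) * (s ^ (q + 1) * y * y) := by positivity
        have e1 : s ^ (q + 2) * y = s ^ (q + 1) * y * s := by ring
        have h4 : 0 ≤ s ^ (q + 1) * y * y := by positivity
        linear_combination e + 2 * h2 + 2 * h3 + 2 * h4
    have e1 : (s + y) ^ (q + 1 + 2) = (s + y) * (s + y) ^ (q + 2) := by ring
    have e2 : |s - y| ^ (q + 1 + 2) = |s - y| * |s - y| ^ (q + 2) := by ring
    rw [e1, e2]
    refine le_trans ?_ h1
    push_cast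
    linear_combination key

/-- The binomial expansion of `(a + b) ^ p` with its two lowest terms in `b` split off. -/
theorem add_pow_eq_add_add_sum_Icc {R : Type*} [CommSemiring R] (a b : R) {p : ℕ} (hp : 1 ≤ p) :
    (a + b) ^ p = a ^ p + p * a ^ (p - 1) * b +
      ∑ k ∈ Finset.Icc 2 p, (p.choose k : R) * a ^ (p - k) * b ^ k := by
  obtain ⟨q, rfl⟩ := Nat.exists_eq_add_of_le' hp
  rw [add_comm a b, add_pow, Finset.range_eq_Ico, Finset.sum_eq_sum_Ico_succ_bot (by omega),
    Finset.sum_eq_sum_Ico_succ_bot (by omega)]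
  have : Finset.Ico 2 (q + 1 + 1) = Finset.Icc 2 (q + 1) := by ext; simp
  rw [this, ← add_assoc]
  congr 1
  · simp; ring
  · exact Finset.sum_congr rfl fun k _ => by ring

/-- A pointwise expansion of `|s + z| ^ p` whose first-order term in `z` is exact. -/
theorem abs_add_pow_le (s z : ℝ) {p : ℕ} (hp : 2 ≤ p) :
    |s + z| ^ p ≤ |s| ^ p + p * (s * |s| ^ (p - 2) * z) +
      ∑ k ∈ Finset.Icc 2 p, (p.choose k : ℝ) * |s| ^ (p - k) * |z| ^ k := by
  have main : ∀ s z : ℝ, 0 ≤ s → |s + z| ^ p ≤ |s| ^ p + p * (s * |s| ^ (p - 2) * z) +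
      ∑ k ∈ Finset.Icc 2 p, (p.choose k : ℝ) * |s| ^ (p - k) * |z| ^ k := by
    intro s z hs
    have h := add_pow_eq_add_add_sum_Icc |s| |z| (show 1 ≤ p by omega)
    obtain ⟨q, rfl⟩ := Nat.exists_eq_add_of_le' hp
    rw [abs_of_nonneg hs] at h ⊢
    rw [show q + 2 - 1 = q + 1 by omega] at h
    rw [show q + 2 - 2 = q by omega]
    rcases le_total 0 z with hz | hz
    · rw [abs_of_nonneg (add_nonneg hs hz)]
      rw [abs_of_nonneg hz] at h ⊢
      rw [h]
      exact le_of_eq (by ring)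
    · have h2 := abs_sub_pow_add_le_add_pow hs (neg_nonneg.2 hz) q
      rw [← abs_of_nonpos hz, h, abs_of_nonpos hz, sub_neg_eq_add] at h2
      rw [abs_of_nonpos hz]
      push_cast at h2 ⊢
      linear_combination h2
  rcases le_total 0 s with hs | hs
  · exact main s z hs
  · have := main (-s) (-z) (by linarith)
    rw [← neg_add, abs_neg, abs_neg, abs_neg] at this
    linear_combination this

/-! ### Bounding the series of higher-order terms -/

/-- For `u = t / P`, the exponential controls the excess moments of a sub-Gaussian variable. -/
theorem one_add_sum_le_exp {t : ℕ} {P K : ℝ} (hP : 0 < P) (hK : 0 < K) (ht : 1 ≤ t) :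
    1 + ∑ k ∈ Finset.Icc 2 t, (t.choose k : ℝ) *
      ((K * √k) / (4 * Real.exp 1 * K * √(P * t))) ^ k ≤ Real.exp (t / P) := by
  set u : ℝ := t / P with hu
  have ht0 : (0 : ℝ) < t := by exact_mod_cast ht
  have hu0 : 0 < u := by positivity
  set E := Real.exp 1 with hE
  have hE2 : 2 ≤ E := by have := Real.add_one_le_exp 1; linarith
  -- Cauchy–Schwarz: each squared term is at most (1/2)^k · u^k/k!, by C(t,k) ≤ t^k/k! and k^k ≤ e^k
  -- k!.
  have hcs := Finset.sum_sq_le_sum_mul_sum_of_sq_le_mul (Finset.Icc 2 t)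
    (r := fun k => (t.choose k : ℝ) * ((K * √k) / (4 * E * K * √(P * t))) ^ k)
    (f := fun k => (1 / 2 : ℝ) ^ k) (g := fun k => u ^ k / (k.factorial : ℝ))
    (fun _ _ => by positivity) (fun _ _ => by positivity) (by
      intro k _
      have hb : (t.choose k : ℝ) ≤ (t : ℝ) ^ k / k.factorial := Nat.choose_le_pow_div k t
      have hf : (0 : ℝ) < k.factorial := by positivity
      have hk : (k : ℝ) ^ k ≤ E ^ k * k.factorial := by
        have := Real.pow_div_factorial_le_exp (k : ℝ) (by positivity) k
        rw [div_le_iff₀ hf] at this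
        rwa [hE, ← Real.exp_nat_mul, mul_one]
      have e1 : (((K * √k) / (4 * E * K * √(P * t))) ^ k) ^ 2
          = (k : ℝ) ^ k / (16 * E ^ 2 * (P * t)) ^ k := by
        rw [← pow_mul, mul_comm k 2, pow_mul, ← div_pow, div_pow, mul_pow, mul_pow, mul_pow,
          mul_pow, Real.sq_sqrt (by positivity), Real.sq_sqrt (by positivity)]
        congr 1
        field_simp
        ring
      have hbase : E * (t : ℝ) ^ 2 / (16 * E ^ 2 * (P * t)) ≤ 1 / 2 * u := by
        have : E * (t : ℝ) ^ 2 / (16 * E ^ 2 * (P * t)) = u / (16 * E) := by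
          rw [hu]; field_simp
        rw [this, div_le_iff₀ (by positivity)]
        nlinarith
      calc ((t.choose k : ℝ) * ((K * √k) / (4 * E * K * √(P * t))) ^ k) ^ 2
          = (t.choose k : ℝ) ^ 2 * ((k : ℝ) ^ k / (16 * E ^ 2 * (P * t)) ^ k) := by
            rw [mul_pow, e1]
        _ ≤ ((t : ℝ) ^ k / k.factorial) ^ 2 *
            ((E ^ k * k.factorial) / (16 * E ^ 2 * (P * t)) ^ k) := by gcongr
        _ = (E * (t : ℝ) ^ 2 / (16 * E ^ 2 * (P * t))) ^ k / k.factorial := by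
            rw [div_pow _ _ k, mul_pow E, ← pow_mul (t : ℝ), mul_comm 2 k, pow_mul (t : ℝ)]
            field_simp
        _ ≤ (1 / 2 * u) ^ k / k.factorial := by gcongr
        _ = _ := by rw [mul_pow]; ring)
  set S := ∑ k ∈ Finset.Icc 2 t, (t.choose k : ℝ) *
      ((K * √k) / (4 * E * K * √(P * t))) ^ k
  have hsplit : ∀ f : ℕ → ℝ, ∑ k ∈ Finset.range (t + 1), f k
      = f 0 + (f 1 + ∑ k ∈ Finset.Icc 2 t, f k) := by
    intro f
    rw [Finset.range_eq_Ico, Finset.sum_eq_sum_Ico_succ_bot (by omega),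
      Finset.sum_eq_sum_Ico_succ_bot (by omega)]
    rfl
  have hgeom : ∑ k ∈ Finset.Icc 2 t, (1 / 2 : ℝ) ^ k ≤ 1 := by
    have h1 := hsplit fun k => (1 / 2 : ℝ) ^ k
    have h2 : ∑ k ∈ Finset.range (t + 1), (1 / 2 : ℝ) ^ k ≤ 2 := sum_geometric_two_le _
    norm_num at h1 h2 ⊢
    linarith
  have hexp : ∑ k ∈ Finset.Icc 2 t, u ^ k / (k.factorial : ℝ) ≤ Real.exp u - 1 - u := by
    have h1 := hsplit fun k => u ^ k / (k.factorial : ℝ)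
    have h2 := Real.sum_le_exp_of_nonneg hu0.le (t + 1)
    simp at h1
    linarith
  -- From 1 - u ≤ exp(-u) the left side is at most u(exp u - 1), and u ≤ exp u - 1.
  have hexp2 : Real.exp u - 1 - u ≤ (Real.exp u - 1) ^ 2 := by
    have h1 := Real.add_one_le_exp u
    have h2 := Real.add_one_le_exp (-u)
    have h3 : Real.exp u * Real.exp (-u) = 1 := by rw [← Real.exp_add]; simp
    have h4 : Real.exp u - 1 ≤ u * Real.exp u := by nlinarith [Real.exp_pos u]
    nlinarith
  have hS : S ^ 2 ≤ (Real.exp u - 1) ^ 2 := by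
    refine hcs.trans (le_trans ?_ (hexp.trans hexp2))
    exact mul_le_of_le_one_left (Finset.sum_nonneg fun _ _ => by positivity) hgeom
  have := abs_le_of_sq_le_sq hS (by have := Real.add_one_le_exp u; linarith)
  linarith [(abs_le.1 this).2]

/-! ### Moments of sums of independent variables -/

theorem eLpNorm_natCast_le_ofReal_iff {α : Type*} [MeasurableSpace α] {μ : Measure α} {f : α → ℝ}
    {k : ℕ} (hk : k ≠ 0) (hf : MemLp f k μ) {c : ℝ} (hc : 0 ≤ c) :
    eLpNorm f k μ ≤ ENNReal.ofReal c ↔ ∫ a, |f a| ^ k ∂μ ≤ c ^ k := by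
  have hI : 0 ≤ ∫ a, |f a| ^ k ∂μ := integral_nonneg fun a => by positivity
  rw [hf.eLpNorm_eq_integral_rpow_norm (by exact_mod_cast hk) (by simp),
    ENNReal.ofReal_le_ofReal_iff hc]
  simp only [ENNReal.toReal_natCast, Real.rpow_natCast, Real.norm_eq_abs]
  rw [Real.rpow_inv_le_iff_of_pos hI hc (by positivity), Real.rpow_natCast]

/-- Monotonicity of L^p norms on a probability space. It lets a bound on the p-th moment of a
partial sum control the lower moments in the expansion. -/
theorem integral_abs_pow_le_of_le {α : Type*} [MeasurableSpace α] {μ : Measure α}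
    [IsProbabilityMeasure μ] {f : α → ℝ} {j p : ℕ} (hjp : j ≤ p) (hf : MemLp f p μ) {c : ℝ}
    (hc : 0 ≤ c) (h : ∫ a, |f a| ^ p ∂μ ≤ c ^ p) : ∫ a, |f a| ^ j ∂μ ≤ c ^ j := by
  rcases eq_or_ne j 0 with rfl | hj
  · simp
  have hle : (j : ENNReal) ≤ p := by exact_mod_cast hjp
  rw [← eLpNorm_natCast_le_ofReal_iff hj (hf.mono_exponent hle) hc]
  exact (eLpNorm_le_eLpNorm_of_exponent_le hle hf.1).trans
    ((eLpNorm_natCast_le_ofReal_iff (by omega) hf hc).2 h)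

section Sum

variable {α : Type*} [MeasurableSpace α] {μ : Measure α} [IsProbabilityMeasure μ]

/-- Adding an independent centered variable raises the `p`-th moment only through the moments of
order at least two of that variable. -/
theorem ProbabilityTheory.IndepFun.integral_abs_add_pow_le {S Z : α → ℝ} (hSZ : IndepFun S Z μ)
    {p : ℕ} (hp : 2 ≤ p) (hS : MemLp S p μ) (hZ : MemLp Z p μ) (hZ0 : ∫ a, Z a ∂μ = 0)
    {Q : ℝ} (hQ : 0 ≤ Q) (hSQ : ∫ a, |S a| ^ p ∂μ ≤ Q ^ p) {b : ℕ → ℝ}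
    (hb : ∀ k ∈ Finset.Icc 2 p, ∫ a, |Z a| ^ k ∂μ ≤ b k) :
    ∫ a, |S a + Z a| ^ p ∂μ ≤
      Q ^ p + ∑ k ∈ Finset.Icc 2 p, (p.choose k : ℝ) * Q ^ (p - k) * b k := by
  have intPow : ∀ {f : α → ℝ}, MemLp f p μ → ∀ j ≤ p, Integrable (fun a => |f a| ^ j) μ :=
    fun hf j hj => (hf.mono_exponent (by exact_mod_cast hj)).integrable_norm_pow' (p := j)
  have hZ1 : Integrable Z μ := hZ.integrable (by exact_mod_cast (by omega : 1 ≤ p))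
  have hg : Measurable fun x : ℝ => x * |x| ^ (p - 2) := by fun_prop
  have hS1 : Integrable (fun a => S a * |S a| ^ (p - 2)) μ := by
    refine (intPow hS (p - 1) (by omega)).mono'
      (hg.comp_aemeasurable hS.1.aemeasurable).aestronglyMeasurable (ae_of_all _ fun a => ?_)
    rw [norm_mul, norm_pow, Real.norm_eq_abs, Real.norm_eq_abs, abs_abs, ← pow_succ',
      show p - 2 + 1 = p - 1 by omega]
  have hind1 : IndepFun (fun a => S a * |S a| ^ (p - 2)) Z μ := hSZ.comp hg measurable_id
  have hindk : ∀ k, IndepFun (fun a => |S a| ^ (p - k)) (fun a => |Z a| ^ k) μ := fun k =>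
    hSZ.comp (φ := fun x => |x| ^ (p - k)) (ψ := fun x => |x| ^ k) (by fun_prop) (by fun_prop)
  have hlin : Integrable (fun a => S a * |S a| ^ (p - 2) * Z a) μ := hind1.integrable_mul hS1 hZ1
  have hterm : ∀ k ∈ Finset.Icc 2 p, Integrable (fun a => |S a| ^ (p - k) * |Z a| ^ k) μ :=
    fun k hk => (hindk k).integrable_mul (intPow hS _ (by omega))
      (intPow hZ _ (Finset.mem_Icc.1 hk).2)
  have hterm' : ∀ k ∈ Finset.Icc 2 p,
      Integrable (fun a => (p.choose k : ℝ) * |S a| ^ (p - k) * |Z a| ^ k) μ := fun k hk => by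
    simpa only [mul_assoc] using (hterm k hk).const_mul (p.choose k : ℝ)
  have hsum := integrable_finsetSum _ hterm'
  have hSp := intPow hS p le_rfl
  have hadd : Integrable (fun a => |S a| ^ p + p * (S a * |S a| ^ (p - 2) * Z a)) μ :=
    hSp.add (hlin.const_mul _)
  calc ∫ a, |S a + Z a| ^ p ∂μ
      ≤ ∫ a, (|S a| ^ p + p * (S a * |S a| ^ (p - 2) * Z a) +
        ∑ k ∈ Finset.Icc 2 p, (p.choose k : ℝ) * |S a| ^ (p - k) * |Z a| ^ k) ∂μ :=
        integral_mono (intPow (hS.add hZ) p le_rfl) (hadd.add hsum)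
          fun a => abs_add_pow_le _ _ hp
    _ = ∫ a, |S a| ^ p ∂μ + ∑ k ∈ Finset.Icc 2 p,
        (p.choose k : ℝ) * ((∫ a, |S a| ^ (p - k) ∂μ) * ∫ a, |Z a| ^ k ∂μ) := by
      rw [integral_add hadd hsum, integral_add hSp (hlin.const_mul _),
        integral_const_mul, hind1.integral_fun_mul_eq_mul_integral hS1.1 hZ1.1, hZ0,
        integral_finsetSum _ hterm']
      simp only [mul_zero, add_zero]
      congr 1
      refine Finset.sum_congr rfl fun k hk => ?_
      simp only [mul_assoc]
      rw [integral_const_mul, (hindk k).integral_fun_mul_eq_mul_integral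
        (intPow hS _ (by omega)).1 (intPow hZ _ (Finset.mem_Icc.1 hk).2).1]
    _ ≤ _ := by
      refine add_le_add hSQ (Finset.sum_le_sum fun k hk => ?_)
      rw [mul_assoc]
      refine mul_le_mul_of_nonneg_left ?_ (by positivity)
      exact mul_le_mul (integral_abs_pow_le_of_le (Nat.sub_le _ _) hS hQ hSQ) (hb k hk)
        (integral_nonneg fun a => by positivity) (by positivity)

/-- A Rosenthal-type bound for the `p`-th moment of a sum of independent centered variables. -/
theorem ProbabilityTheory.iIndepFun.integral_abs_sum_pow_le {ι : Type*} {Z : ι → α → ℝ}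
    (hZ : iIndepFun Z μ) {p : ℕ} (hp : 2 ≤ p) (hLp : ∀ i, MemLp (Z i) p μ)
    (hZ0 : ∀ i, ∫ a, Z i a ∂μ = 0) {c : ℕ → ℝ} (hc : ∀ k, 0 ≤ c k)
    (hb : ∀ i, ∀ k ∈ Finset.Icc 2 p, ∫ a, |Z i a| ^ k ∂μ ≤ c k ^ k) {R : ℝ} (hR : 0 < R)
    (s : Finset ι) :
    ∫ a, |∑ i ∈ s, Z i a| ^ p ∂μ ≤
      R ^ p * (1 + ∑ k ∈ Finset.Icc 2 p, (p.choose k : ℝ) * (c k / R) ^ k) ^ s.card := by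
  classical
  set θ := ∑ k ∈ Finset.Icc 2 p, (p.choose k : ℝ) * (c k / R) ^ k with hθ
  have hθ0 : 0 ≤ θ := Finset.sum_nonneg fun k _ => by have := hc k; positivity
  have hp0 : (p : ℝ) ≠ 0 := by positivity
  induction s using Finset.induction_on with
  | empty => simp [show p ≠ 0 by omega]; positivity
  | insert i s hi ih =>
    -- Q is the p-th root of the inductive bound. Since Q ≥ R, replacing `c k / Q` by `c k / R` only
    -- enlarges the new terms.
    set Q := R * ((1 + θ) ^ s.card) ^ ((p : ℝ)⁻¹) with hQdef
    have h1 : 1 ≤ (1 + θ) ^ s.card := one_le_pow₀ (by linarith)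
    have hRQ : R ≤ Q := le_mul_of_one_le_right hR.le (Real.one_le_rpow h1 (by positivity))
    have hQ0 : 0 < Q := hR.trans_le hRQ
    have hQ : Q ^ p = R ^ p * (1 + θ) ^ s.card := by
      rw [hQdef, mul_pow, Real.rpow_inv_natCast_pow (by positivity) (by omega)]
    rw [← hQ] at ih
    have hind : IndepFun (fun a => ∑ j ∈ s, Z j a) (Z i) μ := by
      have := hZ.indepFun_finsetSum_of_notMem₀ (fun j => (hLp j).1.aemeasurable) hi
      convert this using 1
      ext a; simp
    have key := hind.integral_abs_add_pow_le hp (memLp_finsetSum s fun j _ => hLp j) (hLp i)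
      (hZ0 i) hQ0.le ih (hb i)
    simp_rw [Finset.sum_insert hi, Finset.card_insert_of_notMem hi, add_comm (Z i _)]
    refine key.trans ?_
    rw [pow_succ, ← mul_assoc, ← hQ, mul_add, mul_one, hθ, Finset.mul_sum]
    refine add_le_add_right (Finset.sum_le_sum fun k hk => ?_) _
    have hQk : Q ^ p = Q ^ (p - k) * Q ^ k := by
      rw [← pow_add, Nat.sub_add_cancel (Finset.mem_Icc.1 hk).2]
    have hck := hc k
    calc (p.choose k : ℝ) * Q ^ (p - k) * c k ^ k
        = Q ^ p * ((p.choose k : ℝ) * (c k / Q) ^ k) := by rw [hQk, div_pow]; field_simp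
      _ ≤ _ := by gcongr

/-- Sums of independent centered variables with sub-Gaussian moment growth up to order `t`. -/
theorem ProbabilityTheory.iIndepFun.eLpNorm_sum_le {ι : Type*} [Fintype ι] [Nonempty ι]
    {Z : ι → α → ℝ} (hZ : iIndepFun Z μ) {t : ℕ} (ht : 2 ≤ t)
    (hm : ∀ i, AEStronglyMeasurable (Z i) μ) (hZ0 : ∀ i, ∫ a, Z i a ∂μ = 0) {K : ℝ} (hK : 0 < K)
    (hb : ∀ i, ∀ k ∈ Finset.Icc 2 t, eLpNorm (Z i) k μ ≤ ENNReal.ofReal (K * √k)) :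
    eLpNorm (fun a => ∑ i, Z i a) t μ ≤
      ENNReal.ofReal (4 * Real.exp 1 ^ 2 * K * √(Fintype.card ι * t)) := by
  have hLp : ∀ i, ∀ k ∈ Finset.Icc 2 t, MemLp (Z i) k μ := fun i k hk =>
    ⟨hm i, (hb i k hk).trans_lt ENNReal.ofReal_lt_top⟩
  have htt : t ∈ Finset.Icc 2 t := Finset.mem_Icc.2 ⟨ht, le_rfl⟩
  have hP : (0 : ℝ) < Fintype.card ι := by exact_mod_cast Fintype.card_pos
  have ht0 : (0 : ℝ) < t := by positivity
  set R := 4 * Real.exp 1 * K * √(Fintype.card ι * t) with hR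
  have hR0 : 0 < R := by positivity
  rw [eLpNorm_natCast_le_ofReal_iff (by omega) (memLp_finsetSum _ fun i _ => hLp i t htt)
    (by positivity)]
  refine (hZ.integral_abs_sum_pow_le ht (fun i => hLp i t htt) hZ0 (c := fun k => K * √k)
    (fun k => by positivity) (fun i k hk => (eLpNorm_natCast_le_ofReal_iff
      (by have := (Finset.mem_Icc.1 hk).1; omega) (hLp i k hk) (by positivity)).1 (hb i k hk))
    hR0 Finset.univ).trans ?_
  calc _ ≤ R ^ t * Real.exp (t / Fintype.card ι) ^ Fintype.card ι := by
        rw [Finset.card_univ]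
        refine mul_le_mul_of_nonneg_left (pow_le_pow_left₀ ?_
          (one_add_sum_le_exp hP hK (by omega)) _) (by positivity)
        exact add_nonneg zero_le_one (Finset.sum_nonneg fun k _ => by positivity)
    _ = R ^ t * Real.exp 1 ^ t := by
        rw [← Real.exp_nat_mul, ← Real.exp_nat_mul, mul_div_cancel₀ _ hP.ne', mul_one]
    _ = _ := by rw [← mul_pow, hR]; ring

end Sum

/-! ### Measurability and norms of stacked matrices -/

theorem measurable_matrix_apply {𝕜 : Type*} [MeasurableSpace 𝕜] {m n : ℕ} (i : Fin m)
    (j : Fin n) : Measurable fun M : Matrix (Fin m) (Fin n) 𝕜 => M i j :=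
  (measurable_pi_apply j).comp (measurable_pi_apply (X := fun _ : Fin m => Fin n → 𝕜) i)

theorem measurable_matrix_iff {𝕜 α : Type*} [MeasurableSpace 𝕜] [MeasurableSpace α] {m n : ℕ}
    {f : α → Matrix (Fin m) (Fin n) 𝕜} : Measurable f ↔ ∀ i j, Measurable fun a => f a i j :=
  ⟨fun h i j => (measurable_matrix_apply i j).comp h, fun h =>
    measurable_pi_lambda (X := fun _ : Fin m => Fin n → 𝕜) f fun i =>
      measurable_pi_lambda _ fun j => h i j⟩

section

variable {𝕜 : Type*} [RCLike 𝕜] {P m n : ℕ}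

theorem measurable_norm_toLp_mulVec_sq (x : Fin n → 𝕜) :
    Measurable fun M : Matrix (Fin m) (Fin n) 𝕜 => ‖WithLp.toLp 2 (M *ᵥ x)‖ ^ 2 := by
  simp only [EuclideanSpace.norm_sq_eq, Matrix.mulVec, dotProduct]
  refine Finset.measurable_fun_sum _ fun i _ => Measurable.pow_const (Measurable.norm ?_) 2
  exact Finset.measurable_fun_sum _ fun j _ => (measurable_matrix_apply i j).mul_const _

theorem measurable_smul_vstack (c : 𝕜) :
    Measurable fun A : Fin P → Matrix (Fin m) (Fin n) 𝕜 => c • vstack A :=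
  measurable_matrix_iff.2 fun r j =>
    ((measurable_matrix_apply (finProdFinEquiv.symm r).2 j).comp
      (measurable_pi_apply (finProdFinEquiv.symm r).1)).const_mul c

theorem norm_toLp_smul_vstack_mulVec_sq (A : Fin P → Matrix (Fin m) (Fin n) 𝕜) (x : Fin n → 𝕜) :
    ‖WithLp.toLp 2 ((((1 / √P : ℝ) : 𝕜) • vstack A) *ᵥ x)‖ ^ 2 =
      (P : ℝ)⁻¹ * ∑ i, ‖WithLp.toLp 2 (A i *ᵥ x)‖ ^ 2 := by
  rw [Matrix.smul_mulVec, WithLp.toLp_smul, norm_smul, mul_pow, RCLike.norm_ofReal, sq_abs,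
    div_pow, Real.sq_sqrt (Nat.cast_nonneg P), one_pow, one_div]
  congr 1
  simp only [EuclideanSpace.norm_sq_eq]
  rw [← Fintype.sum_prod_type', ← finProdFinEquiv.symm.sum_comp]
  rfl

end

/-! ### The stacked matrix -/

theorem mainTheorem9 {𝕜 : Type*} [RCLike 𝕜] {P m n : ℕ} (hP : 1 ≤ P)
    {Ω Ω₀ : Type*} [MeasurableSpace Ω] [MeasurableSpace Ω₀]
    (μ : Measure Ω) [IsProbabilityMeasure μ] (ν : Measure Ω₀) [IsProbabilityMeasure ν]
    (ε δ : ℝ) (hε : 0 < ε) (hδ : 0 < δ)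
    (B : Ω₀ → Matrix (Fin m) (Fin n) 𝕜)
    (hB : StrongJLM B ν (Real.sqrt P * ε / (4 * Real.exp 1 ^ 2)) δ)
    (A : Fin P → Ω → Matrix (Fin m) (Fin n) 𝕜)
    (hA_indep : iIndepFun A μ)
    (hA_distrib : ∀ i, IdentDistrib (A i) B μ ν) :
    StrongJLM (fun ω => ((1 / Real.sqrt P : ℝ) : 𝕜) • vstack (fun i => A i ω)) μ ε δ := by
  have hP0 : (0 : ℝ) < P := by exact_mod_cast hP
  have hsq := fun x : EuclideanSpace 𝕜 (Fin n) =>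
    measurable_norm_toLp_mulVec_sq (m := m) x.ofLp
  have hint : ∀ x : EuclideanSpace 𝕜 (Fin n), ‖x‖ = 1 → ∀ i,
      ∫ ω, ‖WithLp.toLp 2 (A i ω *ᵥ x.ofLp)‖ ^ 2 ∂μ = 1 := fun x hx i =>
    ((hA_distrib i).comp (hsq x)).integral_eq.trans (hB.expectation x hx)
  have hintegrable : ∀ x : EuclideanSpace 𝕜 (Fin n), ‖x‖ = 1 → ∀ i,
      Integrable (fun ω => ‖WithLp.toLp 2 (A i ω *ᵥ x.ofLp)‖ ^ 2) μ := fun x hx i =>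
    -- A non-integrable function has integral 0 by convention, so the value 1 forces integrability.
    not_imp_comm.1 integral_undef (by rw [hint x hx i]; exact one_ne_zero)
  refine ⟨?_, fun x hx t ht htL => ?_, fun x hx => ?_⟩
  · exact (measurable_smul_vstack _).comp_aemeasurable
      (aemeasurable_pi_lambda _ fun i => (hA_distrib i).aemeasurable_fst)
  · set L := Real.log (1 / δ)
    have hL : 0 < L := lt_of_lt_of_le (by positivity) htL
    have : Nonempty (Fin P) := ⟨⟨0, hP⟩⟩
    let g : Matrix (Fin m) (Fin n) 𝕜 → ℝ := fun M => ‖WithLp.toLp 2 (M *ᵥ x.ofLp)‖ ^ 2 - 1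
    have hg : Measurable g := (hsq x).sub_const 1
    set K := √P * ε / (4 * Real.exp 1 ^ 2) / Real.exp 1 / √L with hK
    have hK0 : 0 < K := by positivity
    have key := (hA_indep.comp (fun _ => g) fun _ => hg).eLpNorm_sum_le ht
      (fun i => (hg.comp_aemeasurable (hA_distrib i).aemeasurable_fst).aestronglyMeasurable)
      (fun i => by
        change ∫ ω, ‖WithLp.toLp 2 (A i ω *ᵥ x.ofLp)‖ ^ 2 - 1 ∂μ = 0
        rw [integral_sub (hintegrable x hx i) (integrable_const 1), hint x hx i]
        simp) hK0
      (fun i k hk => by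
        obtain ⟨hk2, hkt⟩ := Finset.mem_Icc.1 hk
        rw [((hA_distrib i).comp hg).eLpNorm_eq]
        refine (hB.moment x hx k hk2 (le_trans (by exact_mod_cast hkt) htL)).trans
          (le_of_eq (congrArg _ ?_))
        rw [Real.sqrt_div (Nat.cast_nonneg k), hK]
        ring)
    have hfun : (fun ω => ‖WithLp.toLp 2 ((((1 / √P : ℝ) : 𝕜) • vstack fun i => A i ω) *ᵥ
        x.ofLp)‖ ^ 2 - 1) = (P : ℝ)⁻¹ • fun ω => ∑ i, (g ∘ A i) ω := by
      ext ω
      rw [norm_toLp_smul_vstack_mulVec_sq]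
      simp [g, mul_sub, hP0.ne']
    rw [hfun, eLpNorm_const_smul, Real.enorm_eq_ofReal (by positivity)]
    refine (mul_le_mul_right key _).trans ?_
    rw [← ENNReal.ofReal_mul (by positivity)]
    refine le_of_eq (congrArg _ ?_)
    rw [Fintype.card_fin, Real.sqrt_mul hP0.le, Real.sqrt_div (Nat.cast_nonneg t), hK]
    have hPs : √(P : ℝ) * √P = P := Real.mul_self_sqrt hP0.le
    have hLs : √L ≠ 0 := by positivity
    field_simp
    linear_combination hPs
  · simp_rw [norm_toLp_smul_vstack_mulVec_sq]
    rw [integral_const_mul, integral_finsetSum _ fun i _ => hintegrable x hx i]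
    simp [hint x hx, hP0.ne']
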